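/- Let $Y$ be a computable Polish space, i.e. a complete metric space with a distinguished dense sequence $(s_i)_{i\in\mathbb N}$ such that the reals $d(s_i,s_j)$ are uniformly computable. A sequence of subsets of $Y$ is a computable sequence of c.e. open sets if its members are, uniformly, unions of c.e. sets of rational balls $B(s_i,q)$; the members of a computable sequence of effectively closed sets are the complements of those of a computable sequence of c.e. open sets. Let $\nu$ be a computable Borel probability measure on $Y$, i.e. $\nu(U)$ is left-c.e. uniformly in c.e. open $U$. A point $y\in Y$ is Schnorr $\nu$-random if $y\notin\bigcap_n U_n$ for every computable sequence of c.e. open sets $U_n$ such that the measures $\nu(U_n)$ are uniformly computable and $\nu(U_n)\le 2^{-n}$ for all $n$. A set $B\subseteq Y$ is $\nu$-effectively $\Sigma^0_2$ if $\nu(B)$ is computable and $B=\bigcup_i C_i$ for a computable sequence of effectively closed sets $C_i$ with $\nu(C_i)$ uniformly computable. A computable sequence of $\nu$-effectively $\Sigma^0_2$ sets is a sequence $(B_n)$ for which this holds uniformly in $n$: $B_n=\bigcup_i C_{n,i}$ with $C_{n,i}$ effectively closed uniformly in $(n,i)$, $\nu(C_{n,i})$ computable uniformly in $(n,i)$, and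 $\nu(B_n)$ computable uniformly in $n$. Then a point $y\in Y$ is Schnorr $\nu$-random if and only if $y\notin\bigcap_n B_n$ for every computable sequence of $\nu$-effectively $\Sigma^0_2$ sets $B_n$ with $\nu(B_n)\le 2^{-n}$ for all $n$. -/

import Mathlib

open MeasureTheory

/-- Uniformly computable families of reals: from `a` and `k` one can compute a dyadic rational
`(f - g) / 2 ^ k` within `2 ^ (-k)` of `x a`. -/
def UniformlyComputableReal {α : Type*} [Primcodable α] (x : α → ℝ) : Prop :=
  ∃ f g : α × ℕ → ℕ, Computable f ∧ Computable g ∧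
    ∀ (a : α) (k : ℕ), |x a - ((f (a, k) : ℝ) - (g (a, k) : ℝ)) / 2 ^ k| ≤ (1 / 2 : ℝ) ^ k

/-- Uniformly left-c.e. families of nonnegative reals: the nonnegative rationals
`p / (q + 1)` strictly below `x a` are c.e., uniformly in `a`. -/
def UniformlyLeftCE {α : Type*} [Primcodable α] (x : α → ℝ) : Prop :=
  REPred fun t : α × (ℕ × ℕ) => (t.2.1 : ℝ) / ((t.2.2 : ℝ) + 1) < x t.1

/-- A computable Polish space: a complete metric space with a distinguished dense sequence whose
mutual distances are uniformly computable. -/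
class ComputablePolishSpace (Y : Type*) [MetricSpace Y] extends CompleteSpace Y where
  /-- The distinguished dense sequence. -/
  pt : ℕ → Y
  denseRange_pt : DenseRange pt
  computable_dist : UniformlyComputableReal fun t : ℕ × ℕ => dist (pt t.1) (pt t.2)

section

variable {Y : Type*} [MetricSpace Y] [ComputablePolishSpace Y]

/-- The rational open ball with code `(i, p, q)`: centre `pt i`, radius `p / (q + 1)`
(empty if `p = 0`). -/
def ratBall (Y : Type*) [MetricSpace Y] [ComputablePolishSpace Y] (b : ℕ × ℕ × ℕ) : Set Y :=
  Metric.ball (ComputablePolishSpace.pt b.1) ((b.2.1 : ℝ) / ((b.2.2 : ℝ) + 1))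

/-- Uniformly c.e. open families of sets: `U a` is the union of a set of rational balls that is
c.e. uniformly in `a`. With `α = ℕ` these are the computable sequences of c.e. opens. -/
def UniformlyCEOpen {α : Type*} [Primcodable α] (U : α → Set Y) : Prop :=
  ∃ W : α × (ℕ × ℕ × ℕ) → Prop, REPred W ∧
    ∀ a, U a = ⋃ b ∈ {b : ℕ × ℕ × ℕ | W (a, b)}, ratBall Y b

/-- Uniformly effectively closed families: the complements are uniformly c.e. open. -/
def UniformlyEffectivelyClosed {α : Type*} [Primcodable α] (C : α → Set Y) : Prop :=
  UniformlyCEOpen fun a => (C a)ᶜ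

/-- A computable measure: the measure of c.e. opens is uniformly left-c.e., that is, every
computable sequence of c.e. opens has uniformly left-c.e. measures. -/
def IsComputableMeasure [MeasurableSpace Y] (ν : Measure Y) : Prop :=
  ∀ U : ℕ → Set Y, UniformlyCEOpen U → UniformlyLeftCE fun n => ν.real (U n)

/-- Sequential Schnorr `ν`-tests. -/
def IsSchnorrTest [MeasurableSpace Y] (ν : Measure Y) (U : ℕ → Set Y) : Prop :=
  UniformlyCEOpen U ∧ UniformlyComputableReal (fun n => ν.real (U n)) ∧
    ∀ n, ν.real (U n) ≤ (1 / 2 : ℝ) ^ n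

/-- Schnorr `ν`-random points. -/
def IsSchnorrRandom [MeasurableSpace Y] (ν : Measure Y) (y : Y) : Prop :=
  ∀ U : ℕ → Set Y, IsSchnorrTest ν U → y ∉ ⋂ n, U n

/-- Uniform families of `ν`-effectively `Σ⁰₂` sets: `B a` is the union of a sequence `C a i` that is
uniformly effectively closed, with the measures `ν (C a i)` and `ν (B a)` uniformly computable.
With `α = ℕ` these are the computable sequences of `ν`-effectively `Σ⁰₂` sets, with `α = Unit` one
gets the single `ν`-effectively `Σ⁰₂` sets. -/
def UniformlyEffectiveSigma02 [MeasurableSpace Y] {α : Type*} [Primcodable α]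
    (ν : Measure Y) (B : α → Set Y) : Prop :=
  UniformlyComputableReal (fun a => ν.real (B a)) ∧
    ∃ C : α → ℕ → Set Y,
      UniformlyEffectivelyClosed (fun t : α × ℕ => C t.1 t.2) ∧
      UniformlyComputableReal (fun t : α × ℕ => ν.real (C t.1 t.2)) ∧
      ∀ a, B a = ⋃ i, C a i

end

-- Closure properties of recursively enumerable predicates.

section RecursivelyEnumerable

variable {α β : Type*} [Primcodable α] [Primcodable β]

-- A closed or open rational ball need not have computable measure, because its sphere may carry
-- mass. Only countably many spheres about a centre do, so nested intervals yield computable radii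
-- with null spheres (`IsComputableMeasure.exists_null_radius`). For such a radius the open and the
-- closed ball have the same measure, approximable from below through the open ball and from above
-- through the complement of the closed one. This property, `AlmostDecidable`, passes to complements
-- and finite unions and makes measures computable.
--
-- A c.e. open set is the union of such closed balls, so the members of a Schnorr test are
-- effectively `Σ⁰₂`; this gives one direction.
--
-- Conversely, let `B (n + 1)` be the union of the closed sets `C i`. Exhausting the complement of
-- `C i` by almost decidable balls and stopping when little measure is missing gives an almost
-- decidable open `V i ⊇ C i` of tiny excess
-- (`UniformlyEffectivelyClosed.exists_almostDecidable_superset`). The union of the `V i` contains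
-- `B (n + 1)`, and its measure is left-c.e. It is also right-c.e.: beyond the first `M` sets it
-- gains at most what those `C i` miss of `B (n + 1)`, plus a geometric tail
-- (`measureReal_iUnion_le_of_approx`). Here the computability of `ν (B (n + 1))` is essential.

/-- A predicate is recursively enumerable iff it is the projection of a computable one. -/
theorem rePred_iff_exists_computable {p : α → Prop} :
    REPred p ↔ ∃ f : α × ℕ → Bool, Computable f ∧ ∀ a, p a ↔ ∃ s, f (a, s) = true := by
  constructor
  · intro hp
    obtain ⟨c, hc⟩ := Nat.Partrec.Code.exists_code.1 hp
    -- The stage `s` bounds the evaluation of a code for the semidecision procedure.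
    refine ⟨fun t => (Nat.Partrec.Code.evaln t.2 c (Encodable.encode t.1)).isSome, ?_, fun a => ?_⟩
    · exact Primrec.option_isSome.to_comp.comp
        (Nat.Partrec.Code.primrec_evaln.to_comp.comp
          ((Computable.snd.pair (Computable.const c)).pair
            (Computable.encode.comp Computable.fst)))
    · have h1 : (Nat.Partrec.Code.eval c (Encodable.encode a)).Dom ↔ p a := by
        rw [hc]
        simp [Part.assert]
      rw [← h1, Part.dom_iff_mem]
      simp only [Nat.Partrec.Code.evaln_complete, Option.isSome_iff_exists, Option.mem_def]
      exact exists_comm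
  · rintro ⟨f, hf, h⟩
    have := (Partrec.rfind (p := fun a s => Part.some (f (a, s))) hf.partrec).dom_re
    refine this.of_eq fun a => ?_
    rw [h]
    refine Nat.rfind_dom'.trans ?_
    simp

theorem REPred.comp {p : β → Prop} (hp : REPred p) {f : α → β} (hf : Computable f) :
    REPred fun a => p (f a) :=
  Partrec.comp hp hf

/-- Dovetailing: one number codes both a candidate witness and a stage, and numbers that decode to
nothing count as failures. -/
theorem REPred.exists {p : α × β → Prop} (hp : REPred p) : REPred fun a => ∃ b, p (a, b) := by
  obtain ⟨f, hf, h⟩ := rePred_iff_exists_computable.1 hp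
  refine rePred_iff_exists_computable.2
    ⟨fun t => ((Encodable.decode (α := β × ℕ) t.2).map fun u => f ((t.1, u.1), u.2)).getD false,
      ?_, fun a => ?_⟩
  · refine Computable.option_getD (Computable.option_map (Computable.decode.comp Computable.snd) ?_)
      (Computable.const false)
    exact hf.comp (((Computable.fst.comp Computable.fst).pair
      (Computable.fst.comp Computable.snd)).pair (Computable.snd.comp Computable.snd))
  · simp only [h]
    constructor
    · rintro ⟨b, s, hs⟩
      exact ⟨Encodable.encode (b, s), by simpa using hs⟩
    · rintro ⟨n, hn⟩
      cases hd : Encodable.decode (α := β × ℕ) n with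
      | none => simp [hd] at hn
      | some u => exact ⟨u.1, u.2, by simpa [hd] using hn⟩

theorem REPred.and {p q : α → Prop} (hp : REPred p) (hq : REPred q) :
    REPred fun a => p a ∧ q a := by
  have := (Partrec.bind hp (g := fun a _ => Part.assert (q a) fun _ => Part.some ())
    (Partrec.comp hq Computable.fst)).dom_re
  refine this.of_eq fun a => ?_
  simp [Part.assert]

theorem REPred.or {p q : α → Prop} (hp : REPred p) (hq : REPred q) :
    REPred fun a => p a ∨ q a := by
  obtain ⟨k, hk, h⟩ := Partrec.merge' hp hq
  refine hk.dom_re.of_eq fun a => ?_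
  rw [(h a).2]
  simp [Part.assert]

/-- The semidecision procedures for `j < k` are run one after another; the recursion halts iff all
of them do. -/
theorem REPred.forall_lt {p : α × ℕ → Prop} (hp : REPred p) :
    REPred fun t : α × ℕ => ∀ j < t.2, p (t.1, j) := by
  have := (Partrec.nat_rec (α := α × ℕ) (σ := Unit) (f := fun t => t.2)
    (g := fun _ => Part.some ())
    (h := fun t u => Part.assert (p (t.1, u.1)) fun _ => Part.some ())
    Computable.snd (Computable.const ()).partrec
    (Partrec.comp hp ((Computable.fst.comp Computable.fst).pair
      (Computable.fst.comp Computable.snd)))).dom_re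
  refine this.of_eq ?_
  rintro ⟨a, k⟩
  simp only
  induction k with
  | zero => simp
  | succ k ih =>
    simp only [Part.bind_dom, Part.assert, Nat.forall_lt_succ_right]
    rw [← ih]
    simp only [Part.some_dom, exists_prop, and_true]
    exact Iff.rfl

theorem REPred.of_primrecPred {p : α → Prop} (hp : PrimrecPred p) : REPred p :=
  hp.computablePred.to_re

/-- Uniformisation: a total recursively enumerable relation contains a computable function. -/
theorem REPred.exists_computable_choice {p : α × β → Prop} (hp : REPred p)
    (h : ∀ a, ∃ b, p (a, b)) : ∃ f : α → β, Computable f ∧ ∀ a, p (a, f a) := by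
  obtain ⟨f, hf, hfp⟩ := rePred_iff_exists_computable.1 hp
  -- The number `n` codes a candidate and a stage; the first confirmed candidate is the chosen
  -- value.
  let F : α → ℕ → Option β := fun a n =>
    (Encodable.decode (α := β × ℕ) n).bind fun u => bif f ((a, u.1), u.2) then some u.1 else none
  have hF : Computable₂ F := by
    refine Computable.option_bind (Computable.decode.comp Computable.snd) ?_
    refine Computable.cond (hf.comp (((Computable.fst.comp Computable.fst).pair
      (Computable.fst.comp Computable.snd)).pair (Computable.snd.comp Computable.snd))) ?_
      (Computable.const none)
    exact Computable.option_some.comp (Computable.fst.comp Computable.snd)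
  have hspec : ∀ a n b, b ∈ F a n → p (a, b) := by
    intro a n b hb
    simp only [F, Option.mem_def, Option.bind_eq_some_iff] at hb
    obtain ⟨u, -, hu⟩ := hb
    cases hc : f ((a, u.1), u.2) with
    | false => simp [hc] at hu
    | true =>
      simp only [hc, cond_true, Option.some.injEq] at hu
      subst hu
      exact (hfp _).2 ⟨_, hc⟩
  have hdom : ∀ a, (Nat.rfindOpt (F a)).Dom := by
    intro a
    rw [Nat.rfindOpt_dom]
    obtain ⟨b, hb⟩ := h a
    obtain ⟨s, hs⟩ := (hfp _).1 hb
    exact ⟨Encodable.encode (b, s), b, by simp [F, hs]⟩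
  refine ⟨fun a => (Nat.rfindOpt (F a)).get (hdom a),
    (Partrec.rfindOpt hF).of_eq_tot fun a => Part.get_mem _, fun a => ?_⟩
  obtain ⟨n, hn⟩ := Nat.rfindOpt_spec (Part.get_mem (hdom a))
  exact hspec a n _ hn

end RecursivelyEnumerable

-- Left-c.e. and computable families of reals.

section LowerCE

variable {α β : Type*} [Primcodable α] [Primcodable β]

/-- The rational number `(u - v) / (w + 1)` with code `(u, v, w)`. -/
noncomputable def ratVal (t : ℕ × ℕ × ℕ) : ℝ := ((t.1 : ℝ) - t.2.1) / (t.2.2 + 1)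

theorem exists_ratVal_eq (q : ℚ) : ∃ t, ratVal t = q := by
  refine ⟨(q.num.toNat, (-q.num).toNat, q.den - 1), ?_⟩
  have h1 : ((q.num.toNat : ℝ) - (-q.num).toNat) = q.num := by
    exact_mod_cast Int.toNat_sub_toNat_neg q.num
  have h2 : (((q.den - 1 : ℕ) : ℝ) + 1) = q.den := by
    exact_mod_cast Nat.sub_add_cancel q.pos
  rw [ratVal, h1, h2]
  exact_mod_cast Rat.num_div_den q

theorem exists_ratVal_btwn {x y : ℝ} (h : x < y) : ∃ t, x < ratVal t ∧ ratVal t < y := by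
  obtain ⟨q, h1, h2⟩ := exists_rat_btwn h
  obtain ⟨t, ht⟩ := exists_ratVal_eq q
  exact ⟨t, by rwa [ht], by rwa [ht]⟩

theorem neg_ratVal (t : ℕ × ℕ × ℕ) : -ratVal t = ratVal (t.2.1, t.1, t.2.2) := by
  simp only [ratVal]
  ring

/-- Cross-multiplying and moving negative terms across leaves an inequality between natural numbers,
visibly primitive recursive. -/
theorem ratVal_lt_iff (s t : ℕ × ℕ × ℕ) : ratVal s < ratVal t ↔
    s.1 * (t.2.2 + 1) + t.2.1 * (s.2.2 + 1) < t.1 * (s.2.2 + 1) + s.2.1 * (t.2.2 + 1) := by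
  rw [ratVal, ratVal, div_lt_div_iff₀ (by positivity) (by positivity), ← @Nat.cast_lt ℝ]
  push_cast
  constructor <;> intro h <;> linarith

theorem ratVal_le_add_iff (r s t : ℕ × ℕ × ℕ) : ratVal r ≤ ratVal s + ratVal t ↔
    r.1 * ((s.2.2 + 1) * (t.2.2 + 1)) +
        (s.2.1 * (t.2.2 + 1) + t.2.1 * (s.2.2 + 1)) * (r.2.2 + 1) ≤
      r.2.1 * ((s.2.2 + 1) * (t.2.2 + 1)) +
        (s.1 * (t.2.2 + 1) + t.1 * (s.2.2 + 1)) * (r.2.2 + 1) := by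
  rw [ratVal, ratVal, ratVal, div_add_div _ _ (by positivity) (by positivity),
    div_le_div_iff₀ (by positivity) (by positivity), ← @Nat.cast_le ℝ]
  push_cast
  constructor <;> intro h <;> linarith

theorem primrecPred_ratVal_lt :
    PrimrecPred fun u : (ℕ × ℕ × ℕ) × (ℕ × ℕ × ℕ) => ratVal u.1 < ratVal u.2 := by
  simp only [ratVal_lt_iff]
  have s1 : Primrec fun u : (ℕ × ℕ × ℕ) × (ℕ × ℕ × ℕ) => u.1.1 := .comp .fst .fst
  have s2 : Primrec fun u : (ℕ × ℕ × ℕ) × (ℕ × ℕ × ℕ) => u.1.2.1 :=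
    .comp .fst (.comp .snd .fst)
  have s3 : Primrec fun u : (ℕ × ℕ × ℕ) × (ℕ × ℕ × ℕ) => u.1.2.2 + 1 :=
    .comp .succ (.comp .snd (.comp .snd .fst))
  have t1 : Primrec fun u : (ℕ × ℕ × ℕ) × (ℕ × ℕ × ℕ) => u.2.1 := .comp .fst .snd
  have t2 : Primrec fun u : (ℕ × ℕ × ℕ) × (ℕ × ℕ × ℕ) => u.2.2.1 :=
    .comp .fst (.comp .snd .snd)
  have t3 : Primrec fun u : (ℕ × ℕ × ℕ) × (ℕ × ℕ × ℕ) => u.2.2.2 + 1 :=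
    .comp .succ (.comp .snd (.comp .snd .snd))
  exact Primrec.nat_lt.comp
    (Primrec.nat_add.comp (Primrec.nat_mul.comp s1 t3) (Primrec.nat_mul.comp t2 s3))
    (Primrec.nat_add.comp (Primrec.nat_mul.comp t1 s3) (Primrec.nat_mul.comp s2 t3))

theorem primrecPred_ratVal_le_add :
    PrimrecPred fun u : (ℕ × ℕ × ℕ) × (ℕ × ℕ × ℕ) × (ℕ × ℕ × ℕ) =>
      ratVal u.1 ≤ ratVal u.2.1 + ratVal u.2.2 := by
  simp only [ratVal_le_add_iff]
  have p1 {f : (ℕ × ℕ × ℕ) × (ℕ × ℕ × ℕ) × (ℕ × ℕ × ℕ) → ℕ × ℕ × ℕ} (hf : Primrec f) :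
      Primrec fun u => (f u).1 := .comp .fst hf
  have p2 {f : (ℕ × ℕ × ℕ) × (ℕ × ℕ × ℕ) × (ℕ × ℕ × ℕ) → ℕ × ℕ × ℕ} (hf : Primrec f) :
      Primrec fun u => (f u).2.1 := .comp .fst (.comp .snd hf)
  have p3 {f : (ℕ × ℕ × ℕ) × (ℕ × ℕ × ℕ) × (ℕ × ℕ × ℕ) → ℕ × ℕ × ℕ} (hf : Primrec f) :
      Primrec fun u => (f u).2.2 + 1 := .comp .succ (.comp .snd (.comp .snd hf))
  have r : Primrec fun u : (ℕ × ℕ × ℕ) × (ℕ × ℕ × ℕ) × (ℕ × ℕ × ℕ) => u.1 := .fst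
  have s : Primrec fun u : (ℕ × ℕ × ℕ) × (ℕ × ℕ × ℕ) × (ℕ × ℕ × ℕ) => u.2.1 := .comp .fst .snd
  have t : Primrec fun u : (ℕ × ℕ × ℕ) × (ℕ × ℕ × ℕ) × (ℕ × ℕ × ℕ) => u.2.2 := .comp .snd .snd
  have m {f g : (ℕ × ℕ × ℕ) × (ℕ × ℕ × ℕ) × (ℕ × ℕ × ℕ) → ℕ} (hf : Primrec f) (hg : Primrec g) :
      Primrec fun u => f u * g u := Primrec.nat_mul.comp hf hg
  have a {f g : (ℕ × ℕ × ℕ) × (ℕ × ℕ × ℕ) × (ℕ × ℕ × ℕ) → ℕ} (hf : Primrec f) (hg : Primrec g) :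
      Primrec fun u => f u + g u := Primrec.nat_add.comp hf hg
  exact Primrec.nat_le.comp
    (a (m (p1 r) (m (p3 s) (p3 t))) (m (a (m (p2 s) (p3 t)) (m (p2 t) (p3 s))) (p3 r)))
    (a (m (p2 r) (m (p3 s) (p3 t))) (m (a (m (p1 s) (p3 t)) (m (p1 t) (p3 s))) (p3 r)))

/-- Uniformly left-c.e. families of arbitrary (possibly negative) reals. -/
def LowerCE (x : α → ℝ) : Prop :=
  REPred fun t : α × (ℕ × ℕ × ℕ) => ratVal t.2 < x t.1

theorem LowerCE.comp {x : β → ℝ} (hx : LowerCE x) {f : α → β} (hf : Computable f) :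
    LowerCE fun a => x (f a) := by
  have h := REPred.comp (α := α × (ℕ × ℕ × ℕ)) hx
    ((hf.comp Computable.fst).pair Computable.snd)
  exact h

theorem lowerCE_ratVal {c : α → ℕ × ℕ × ℕ} (hc : Computable c) :
    LowerCE fun a => ratVal (c a) := by
  have h := REPred.comp (α := α × (ℕ × ℕ × ℕ)) (REPred.of_primrecPred primrecPred_ratVal_lt)
    (Computable.snd.pair (hc.comp Computable.fst))
  exact h

/-- The pointwise supremum of a uniformly left-c.e. family is left-c.e. -/
theorem LowerCE.of_sup {x : α → ℝ} {y : α × β → ℝ} (hy : LowerCE y)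
    (hle : ∀ a b, y (a, b) ≤ x a) (hlt : ∀ a c, c < x a → ∃ b, c < y (a, b)) : LowerCE x := by
  have h := REPred.comp (α := (α × (ℕ × ℕ × ℕ)) × β) hy
    (((Computable.fst.comp Computable.fst).pair Computable.snd).pair
      (Computable.snd.comp Computable.fst))
  exact h.exists.of_eq fun t => ⟨fun ⟨b, hb⟩ => hb.trans_le (hle _ _), fun ht => hlt _ _ ht⟩

/-- A rational lies below a sum iff it is at most the sum of two rationals, each below its summand.
-/
theorem LowerCE.add {x y : α → ℝ} (hx : LowerCE x) (hy : LowerCE y) :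
    LowerCE fun a => x a + y a := by
  have hx' := REPred.comp (α := (α × (ℕ × ℕ × ℕ)) × (ℕ × ℕ × ℕ) × (ℕ × ℕ × ℕ)) hx
    ((Computable.fst.comp Computable.fst).pair (Computable.fst.comp Computable.snd))
  have hy' := REPred.comp (α := (α × (ℕ × ℕ × ℕ)) × (ℕ × ℕ × ℕ) × (ℕ × ℕ × ℕ)) hy
    ((Computable.fst.comp Computable.fst).pair (Computable.snd.comp Computable.snd))
  have hxy := REPred.comp (α := (α × (ℕ × ℕ × ℕ)) × (ℕ × ℕ × ℕ) × (ℕ × ℕ × ℕ))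
    (REPred.of_primrecPred primrecPred_ratVal_le_add)
    ((Computable.snd.comp Computable.fst).pair Computable.snd)
  refine (hxy.and (hx'.and hy')).exists.of_eq fun t => ⟨?_, fun ht => ?_⟩
  · rintro ⟨b, h1, h2, h3⟩
    exact h1.trans_lt (add_lt_add h2 h3)
  · obtain ⟨s, hs1, hs2⟩ := exists_ratVal_btwn (sub_lt_iff_lt_add.2 ht)
    obtain ⟨r, hr1, hr2⟩ := exists_ratVal_btwn (sub_lt_comm.1 hs1)
    exact ⟨(s, r), by simp only; linarith, hs2, hr2⟩

/-- Strict inequality is semidecidable once the smaller side is known from above and the larger from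
below. -/
theorem LowerCE.lt {x y : α → ℝ} (hx : LowerCE fun a => -x a) (hy : LowerCE y) :
    REPred fun a => x a < y a := by
  refine (REPred.comp (α := α) (hx.add hy)
    (Computable.id.pair (Computable.const (0, 0, 0)))).of_eq fun a => ?_
  simp [ratVal]

theorem computable_two_pow_sub_one : Computable fun k : ℕ => 2 ^ k - 1 := by
  have h : Primrec fun k : ℕ => 2 ^ k := by
    refine (Primrec.nat_rec₁ (f := fun _ x => 2 * x) 1
      (Primrec.nat_mul.comp (Primrec.const 2) Primrec.snd)).of_eq fun k => ?_
    induction k with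
    | zero => rfl
    | succ k ih => rw [pow_succ, ← ih, mul_comm]
  exact (Primrec.nat_sub.comp h (Primrec.const 1)).to_comp

theorem ratVal_two_pow (u v k : ℕ) : ratVal (u, v, 2 ^ k - 1) = ((u : ℝ) - v) / 2 ^ k := by
  have : ((2 ^ k - 1 : ℕ) : ℝ) + 1 = 2 ^ k := by
    exact_mod_cast Nat.sub_add_cancel Nat.one_le_two_pow
  rw [ratVal, this]

/-- A family of reals is uniformly computable iff it is left-c.e. and right-c.e. -/
theorem uniformlyComputableReal_iff {x : α → ℝ} :
    UniformlyComputableReal x ↔ LowerCE x ∧ LowerCE fun a => -x a := by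
  have hpow : Computable fun t : α × ℕ => 2 ^ t.2 - 1 :=
    computable_two_pow_sub_one.comp Computable.snd
  constructor
  · rintro ⟨f, g, hf, hg, h⟩
    have small : ∀ ε : ℝ, 0 < ε → ∃ k : ℕ, 2 * (1 / 2 : ℝ) ^ k < ε := by
      intro ε hε
      obtain ⟨k, hk⟩ := exists_pow_lt_of_lt_one (half_pos hε) (by norm_num : (1 / 2 : ℝ) < 1)
      exact ⟨k, by linarith⟩
    have hone : ∀ k : ℕ, (1 : ℝ) / 2 ^ k = (1 / 2) ^ k := fun k => by simp
    constructor
    -- Lowering the approximation by its error `2 ^ (-k)` gives a lower bound that is off by at most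
    -- twice that error.
    · refine LowerCE.of_sup (y := fun t : α × ℕ => ratVal (f t, g t + 1, 2 ^ t.2 - 1))
        (lowerCE_ratVal (hf.pair ((Computable.succ.comp hg).pair hpow))) ?_ ?_
      · intro a k
        have := abs_le.1 (h a k)
        rw [ratVal_two_pow]
        push_cast
        rw [← sub_sub, sub_div, hone]
        linarith
      · intro a c hc
        obtain ⟨k, hk⟩ := small _ (sub_pos.2 hc)
        refine ⟨k, ?_⟩
        have := abs_le.1 (h a k)
        simp only
        rw [ratVal_two_pow]
        push_cast
        rw [← sub_sub, sub_div, hone]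
        linarith
    · refine LowerCE.of_sup (y := fun t : α × ℕ => ratVal (g t, f t + 1, 2 ^ t.2 - 1))
        (lowerCE_ratVal (hg.pair ((Computable.succ.comp hf).pair hpow))) ?_ ?_
      · intro a k
        have := abs_le.1 (h a k)
        rw [ratVal_two_pow]
        push_cast
        rw [← sub_sub, sub_div, hone, ← neg_sub (f (a, k) : ℝ), neg_div]
        linarith
      · intro a c hc
        obtain ⟨k, hk⟩ := small _ (sub_pos.2 hc)
        refine ⟨k, ?_⟩
        have := abs_le.1 (h a k)
        simp only
        rw [ratVal_two_pow]
        push_cast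
        rw [← sub_sub, sub_div, hone, ← neg_sub (f (a, k) : ℝ), neg_div]
        linarith
  · rintro ⟨h1, h2⟩
    have hu : Computable fun t : (α × ℕ) × (ℕ × ℕ) => t.2.1 := .comp .fst .snd
    have hv : Computable fun t : (α × ℕ) × (ℕ × ℕ) => t.2.2 := .comp .snd .snd
    have hp : Computable fun t : (α × ℕ) × (ℕ × ℕ) => 2 ^ t.1.2 - 1 := hpow.comp .fst
    have ha : Computable fun t : (α × ℕ) × (ℕ × ℕ) => t.1.1 := .comp .fst .fst
    have r1 : REPred fun t : (α × ℕ) × (ℕ × ℕ) =>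
        x t.1.1 < ratVal (t.2.1 + 1, t.2.2, 2 ^ t.1.2 - 1) :=
      (h2.comp ha).lt (lowerCE_ratVal ((Computable.succ.comp hu).pair (hv.pair hp)))
    have r2 : REPred fun t : (α × ℕ) × (ℕ × ℕ) =>
        ratVal (t.2.1, t.2.2 + 1, 2 ^ t.1.2 - 1) < x t.1.1 := by
      refine LowerCE.lt ?_ (h1.comp ha)
      simp only [neg_ratVal]
      exact lowerCE_ratVal ((Computable.succ.comp hv).pair (hu.pair hp))
    -- The search is for an integer `u - v` strictly within `1` of `x * 2 ^ k`: an open, hence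
    -- semidecidable, condition, met by the floor.
    obtain ⟨F, hF, hFs⟩ := (r1.and r2).exists_computable_choice (by
      rintro ⟨a, k⟩
      set z : ℤ := ⌊x a * 2 ^ k⌋ with hz
      have hz1 : ((z.toNat : ℝ) - (-z).toNat) = z := by
        exact_mod_cast Int.toNat_sub_toNat_neg z
      refine ⟨(z.toNat, (-z).toNat), ?_, ?_⟩
      · simp only
        rw [ratVal_two_pow, lt_div_iff₀ (by positivity)]
        push_cast
        linarith [Int.lt_floor_add_one (x a * 2 ^ k)]
      · simp only
        rw [ratVal_two_pow, div_lt_iff₀ (by positivity)]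
        push_cast
        linarith [Int.floor_le (x a * 2 ^ k)])
    refine ⟨fun t => (F t).1, fun t => (F t).2, Computable.fst.comp hF, Computable.snd.comp hF,
      fun a k => ?_⟩
    obtain ⟨h3, h4⟩ := hFs (a, k)
    simp only [ratVal_two_pow] at h3 h4
    rw [lt_div_iff₀ (by positivity)] at h3
    rw [div_lt_iff₀ (by positivity)] at h4
    push_cast at h3 h4
    have hpos : (0 : ℝ) < 2 ^ k := by positivity
    have : x a - (((F (a, k)).1 : ℝ) - (F (a, k)).2) / 2 ^ k =
        (x a * 2 ^ k - (((F (a, k)).1 : ℝ) - (F (a, k)).2)) / 2 ^ k := by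
      field_simp
    rw [this, abs_div, abs_of_pos hpos, one_div_pow]
    refine div_le_div_of_nonneg_right ?_ hpos.le
    rw [abs_le]
    constructor <;> linarith

theorem UniformlyComputableReal.lowerCE {x : α → ℝ} (hx : UniformlyComputableReal x) :
    LowerCE x := (uniformlyComputableReal_iff.1 hx).1

theorem UniformlyComputableReal.lowerCE_neg {x : α → ℝ} (hx : UniformlyComputableReal x) :
    LowerCE fun a => -x a := (uniformlyComputableReal_iff.1 hx).2

theorem UniformlyComputableReal.neg {x : α → ℝ} (hx : UniformlyComputableReal x) :
    UniformlyComputableReal fun a => -x a :=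
  uniformlyComputableReal_iff.2 ⟨hx.lowerCE_neg, by simpa using hx.lowerCE⟩

theorem UniformlyComputableReal.add {x y : α → ℝ} (hx : UniformlyComputableReal x)
    (hy : UniformlyComputableReal y) : UniformlyComputableReal fun a => x a + y a :=
  uniformlyComputableReal_iff.2 ⟨hx.lowerCE.add hy.lowerCE, by
    simpa only [neg_add] using hx.lowerCE_neg.add hy.lowerCE_neg⟩

theorem UniformlyComputableReal.sub {x y : α → ℝ} (hx : UniformlyComputableReal x)
    (hy : UniformlyComputableReal y) : UniformlyComputableReal fun a => x a - y a := by
  simpa only [sub_eq_add_neg] using hx.add hy.neg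

theorem UniformlyComputableReal.lt {x y : α → ℝ} (hx : UniformlyComputableReal x)
    (hy : UniformlyComputableReal y) : REPred fun a => x a < y a :=
  hx.lowerCE_neg.lt hy.lowerCE

theorem UniformlyComputableReal.comp {x : β → ℝ} (hx : UniformlyComputableReal x) {f : α → β}
    (hf : Computable f) : UniformlyComputableReal fun a => x (f a) :=
  uniformlyComputableReal_iff.2 ⟨hx.lowerCE.comp hf, hx.lowerCE_neg.comp hf⟩

theorem uniformlyComputableReal_ratVal {c : α → ℕ × ℕ × ℕ} (hc : Computable c) :
    UniformlyComputableReal fun a => ratVal (c a) := by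
  refine uniformlyComputableReal_iff.2 ⟨lowerCE_ratVal hc, ?_⟩
  simp only [neg_ratVal]
  exact lowerCE_ratVal ((Computable.fst.comp (Computable.snd.comp hc)).pair
    ((Computable.fst.comp hc).pair (Computable.snd.comp (Computable.snd.comp hc))))

theorem uniformlyComputableReal_half_pow {k : α → ℕ} (hk : Computable k) :
    UniformlyComputableReal fun a => (1 / 2 : ℝ) ^ k a := by
  have := uniformlyComputableReal_ratVal ((Computable.const 1).pair
    ((Computable.const 0).pair (computable_two_pow_sub_one.comp hk)))
  simpa [ratVal_two_pow] using this

theorem uniformlyComputableReal_one : UniformlyComputableReal fun _ : α => (1 : ℝ) := by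
  simpa using uniformlyComputableReal_half_pow (Computable.const (α := α) 0)

/-- Negative rationals, absent from `UniformlyLeftCE`, lie below a nonnegative real automatically.
-/
theorem UniformlyLeftCE.lowerCE {x : α → ℝ} (hx : UniformlyLeftCE x) (h0 : ∀ a, 0 ≤ x a) :
    LowerCE x := by
  have hu : Primrec fun t : α × (ℕ × ℕ × ℕ) => t.2.1 := .comp .fst .snd
  have hv : Primrec fun t : α × (ℕ × ℕ × ℕ) => t.2.2.1 := .comp .fst (.comp .snd .snd)
  have hw : Primrec fun t : α × (ℕ × ℕ × ℕ) => t.2.2.2 := .comp .snd (.comp .snd .snd)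
  have h1 : REPred fun t : α × (ℕ × ℕ × ℕ) => t.2.1 < t.2.2.1 :=
    REPred.of_primrecPred (Primrec.nat_lt.comp hu hv)
  have h2 := REPred.comp (α := α × (ℕ × ℕ × ℕ)) hx
    (Computable.fst.pair ((Primrec.nat_sub.comp hu hv).to_comp.pair hw.to_comp))
  refine (h1.or h2).of_eq ?_
  rintro ⟨a, u, v, w⟩
  simp only [ratVal]
  have hw : (0 : ℝ) < w + 1 := by positivity
  rcases lt_or_ge u v with h | h
  · have : ((u : ℝ) - v) / (w + 1) < 0 :=
      div_neg_of_neg_of_pos (sub_neg.2 (by exact_mod_cast h)) hw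
    simp [h, this.trans_le (h0 a)]
  · rw [Nat.cast_sub h]
    simp [h.not_gt]

end LowerCE

-- Operations on c.e. open sets.

section CEOpen

variable {α β : Type*} [Primcodable α] [Primcodable β]
variable {Y : Type*} [MetricSpace Y] [ComputablePolishSpace Y]

open ComputablePolishSpace

/-- The radius of the rational ball with code `b`. -/
noncomputable def ratRadius (b : ℕ × ℕ × ℕ) : ℝ := (b.2.1 : ℝ) / ((b.2.2 : ℝ) + 1)

theorem ratRadius_eq_ratVal (b : ℕ × ℕ × ℕ) : ratRadius b = ratVal (b.2.1, 0, b.2.2) := by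
  simp [ratRadius, ratVal]

theorem mem_ratBall {b : ℕ × ℕ × ℕ} {x : Y} :
    x ∈ ratBall Y b ↔ dist x (pt b.1) < ratRadius b := Iff.rfl

theorem exists_ratRadius_btwn {x y : ℝ} (hx : 0 ≤ x) (h : x < y) (i : ℕ) :
    ∃ b : ℕ × ℕ × ℕ, b.1 = i ∧ x < ratRadius b ∧ ratRadius b < y := by
  obtain ⟨⟨u, v, w⟩, h1, h2⟩ := exists_ratVal_btwn h
  have hw : (0 : ℝ) < w + 1 := by positivity
  have huv : v ≤ u := by
    by_contra! hlt
    have : ratVal (u, v, w) < 0 :=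
      div_neg_of_neg_of_pos (sub_neg.2 (by exact_mod_cast hlt)) hw
    linarith
  refine ⟨(i, u - v, w), rfl, ?_⟩
  have : ratRadius (i, u - v, w) = ratVal (u, v, w) := by
    simp [ratRadius, ratVal, Nat.cast_sub huv]
  rw [this]
  exact ⟨h1, h2⟩

theorem uniformlyComputableReal_ratRadius {c : α → ℕ × ℕ × ℕ} (hc : Computable c) :
    UniformlyComputableReal fun a => ratRadius (c a) := by
  simp only [ratRadius_eq_ratVal]
  exact uniformlyComputableReal_ratVal ((Computable.fst.comp (Computable.snd.comp hc)).pair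
    ((Computable.const 0).pair (Computable.snd.comp (Computable.snd.comp hc))))

theorem uniformlyComputableReal_dist_pt (Y : Type*) [MetricSpace Y] [ComputablePolishSpace Y]
    {i j : α → ℕ} (hi : Computable i) (hj : Computable j) :
    UniformlyComputableReal fun a => dist (pt (i a) : Y) (pt (j a)) :=
  UniformlyComputableReal.comp (computable_dist (Y := Y)) (hi.pair hj)

variable (Y) in
theorem exists_small_ratBall (x : Y) {ε : ℝ} (hε : 0 < ε) :
    ∃ b, x ∈ ratBall Y b ∧ ratRadius b < ε := by
  obtain ⟨i, hi⟩ := (denseRange_pt (Y := Y)).exists_dist_lt x hε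
  obtain ⟨b, rfl, h1, h2⟩ := exists_ratRadius_btwn dist_nonneg hi i
  exact ⟨b, h1, h2⟩

theorem UniformlyCEOpen.isOpen {U : α → Set Y} (hU : UniformlyCEOpen U) (a : α) :
    IsOpen (U a) := by
  obtain ⟨W, -, h⟩ := hU
  rw [h]
  exact isOpen_biUnion fun b _ => Metric.isOpen_ball

theorem UniformlyCEOpen.comp {U : β → Set Y} (hU : UniformlyCEOpen U) {f : α → β}
    (hf : Computable f) : UniformlyCEOpen fun a => U (f a) := by
  obtain ⟨W, hW, h⟩ := hU
  exact ⟨fun t => W (f t.1, t.2), hW.comp ((hf.comp Computable.fst).pair Computable.snd),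
    fun a => h (f a)⟩

/-- Unions over recursively enumerable index sets are c.e. open. -/
theorem UniformlyCEOpen.of_exists {U : α × β → Set Y} (hU : UniformlyCEOpen U)
    {R : α × β → Prop} (hR : REPred R) {V : α → Set Y}
    (hV : ∀ a x, x ∈ V a ↔ ∃ b, R (a, b) ∧ x ∈ U (a, b)) : UniformlyCEOpen V := by
  obtain ⟨W, hW, h⟩ := hU
  have h1 := REPred.comp (α := (α × (ℕ × ℕ × ℕ)) × β) hR
    ((Computable.fst.comp Computable.fst).pair Computable.snd)
  have h2 := REPred.comp (α := (α × (ℕ × ℕ × ℕ)) × β) hW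
    (((Computable.fst.comp Computable.fst).pair Computable.snd).pair
      (Computable.snd.comp Computable.fst))
  refine ⟨_, (h1.and h2).exists, fun a => ?_⟩
  ext x
  simp only [hV, h, Set.mem_iUnion, Set.mem_ofPred_eq, exists_prop]
  constructor
  · rintro ⟨b, hb, c, hc, hx⟩
    exact ⟨c, ⟨b, hb, hc⟩, hx⟩
  · rintro ⟨c, ⟨b, hb, hc⟩, hx⟩
    exact ⟨b, hb, c, hc, hx⟩

theorem uniformlyCEOpen_ratBall : UniformlyCEOpen (ratBall Y) := by
  refine ⟨fun t => t.1 = t.2, REPred.of_primrecPred (Primrec.eq.comp .fst .snd), fun a => ?_⟩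
  ext x
  simp

theorem UniformlyCEOpen.iUnion {U : α × β → Set Y} (hU : UniformlyCEOpen U) :
    UniformlyCEOpen fun a => ⋃ b, U (a, b) :=
  hU.of_exists (R := fun _ => True) 
    (rePred_iff_exists_computable.2 ⟨fun _ => true, Computable.const _, by simp⟩) (by simp)

theorem UniformlyCEOpen.iUnion_lt {U : α × ℕ → Set Y} (hU : UniformlyCEOpen U) :
    UniformlyCEOpen fun t : α × ℕ => ⋃ j < t.2, U (t.1, j) := by
  have h : UniformlyCEOpen fun u : (α × ℕ) × ℕ => U (u.1.1, u.2) :=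
    hU.comp ((Computable.fst.comp Computable.fst).pair Computable.snd)
  refine h.of_exists (R := fun u => u.2 < u.1.2)
    (REPred.of_primrecPred (Primrec.nat_lt.comp .snd (.comp .snd .fst))) (by simp)

theorem UniformlyCEOpen.union {U V : α → Set Y} (hU : UniformlyCEOpen U)
    (hV : UniformlyCEOpen V) : UniformlyCEOpen fun a => U a ∪ V a := by
  obtain ⟨W, hW, h⟩ := hU
  obtain ⟨W', hW', h'⟩ := hV
  refine ⟨_, hW.or hW', fun a => ?_⟩
  ext x
  simp only [h, h', Set.mem_union, Set.mem_iUnion, Set.mem_ofPred_eq, exists_prop, or_and_right,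
    exists_or]

theorem exists_pos_forall_lt_le {f : ℕ → ℝ} (hf : ∀ j, 0 < f j) (k : ℕ) :
    ∃ ε > 0, ∀ j < k, ε ≤ f j := by
  induction k with
  | zero => exact ⟨1, one_pos, by simp⟩
  | succ k ih =>
    obtain ⟨ε, hε, h⟩ := ih
    refine ⟨min ε (f k), lt_min hε (hf k), fun j hj => ?_⟩
    rcases Nat.lt_succ_iff_lt_or_eq.1 hj with hj | rfl
    · exact (min_le_left _ _).trans (h j hj)
    · exact min_le_right _ _

/-- A ball is enumerated when, for each `j < k`, it is formally included in an enumerated ball of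
the `j`-th set: distance of centres plus its radius is less than the other radius. Unlike actual
inclusion, this is plainly semidecidable. -/
theorem UniformlyCEOpen.iInter_lt {U : α × ℕ → Set Y} (hU : UniformlyCEOpen U) :
    UniformlyCEOpen fun t : α × ℕ => ⋂ j < t.2, U (t.1, j) := by
  obtain ⟨W, hW, h⟩ := hU
  have hc : Computable fun u : ((α × (ℕ × ℕ × ℕ)) × ℕ) × (ℕ × ℕ × ℕ) => u.1.1.2 :=
    .comp .snd (.comp .fst .fst)
  have h1 := REPred.comp (α := ((α × (ℕ × ℕ × ℕ)) × ℕ) × (ℕ × ℕ × ℕ)) hW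
    (((Computable.fst.comp (Computable.fst.comp Computable.fst)).pair
      (Computable.snd.comp Computable.fst)).pair Computable.snd)
  have h2 := ((uniformlyComputableReal_dist_pt Y (Computable.fst.comp hc)
    (Computable.fst.comp Computable.snd)).add (uniformlyComputableReal_ratRadius hc)).lt
    (uniformlyComputableReal_ratRadius Computable.snd)
  have h3 := (h1.and h2).exists.forall_lt
  refine ⟨_, REPred.comp (α := (α × ℕ) × (ℕ × ℕ × ℕ)) h3
    (((Computable.fst.comp Computable.fst).pair Computable.snd).pair
      (Computable.snd.comp Computable.fst)), ?_⟩
  rintro ⟨a, k⟩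
  ext x
  simp only [h, Set.mem_iInter, Set.mem_iUnion, Set.mem_ofPred_eq, exists_prop]
  constructor
  · intro hx
    have hx' : ∀ j, ∃ b, j < k → W ((a, j), b) ∧ x ∈ ratBall Y b := by
      intro j
      by_cases hj : j < k
      · obtain ⟨b, hb⟩ := hx j hj
        exact ⟨b, fun _ => hb⟩
      · exact ⟨(0, 0, 0), fun hj' => absurd hj' hj⟩
    choose b hb using hx'
    obtain ⟨ε, hε, hεj⟩ := exists_pos_forall_lt_le
      (f := fun j => if j < k then ratRadius (b j) - dist x (pt (b j).1) else 1) (by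
        intro j
        split_ifs with hj
        · exact sub_pos.2 (hb j hj).2
        · exact one_pos) k
    -- Half the least slack suffices, since the radius of `c` enters twice: through its distance to
    -- `x` and through itself.
    obtain ⟨c, hxc, hcε⟩ := exists_small_ratBall Y x (half_pos hε)
    refine ⟨c, fun j hj => ⟨b j, (hb j hj).1, ?_⟩, hxc⟩
    have h4 := hεj j hj
    rw [if_pos hj] at h4
    have h5 := dist_triangle_left (pt c.1 : Y) (pt (b j).1) x
    have h6 := mem_ratBall.1 hxc
    linarith
  · rintro ⟨c, hc, hxc⟩ j hj
    obtain ⟨b, hb, hlt⟩ := hc j hj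
    refine ⟨b, hb, ?_⟩
    have h5 := dist_triangle x (pt c.1 : Y) (pt b.1)
    have h6 := mem_ratBall.1 hxc
    rw [mem_ratBall]
    linarith

/-- Concentric balls of smaller rational radius exhaust the ball, so lower bounds for the radius
suffice. -/
theorem uniformlyCEOpen_ball {i : α → ℕ} (hi : Computable i) {r : α → ℝ} (hr : LowerCE r) :
    UniformlyCEOpen fun a => Metric.ball (pt (i a) : Y) (r a) := by
  have h1 : REPred fun t : α × (ℕ × ℕ × ℕ) => t.2.1 = i t.1 :=
    (REPred.of_primrecPred (Primrec.eq (α := ℕ))).comp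
      ((Computable.fst.comp Computable.snd).pair (hi.comp Computable.fst))
  have h2 : REPred fun t : α × (ℕ × ℕ × ℕ) => ratRadius t.2 < r t.1 :=
    (uniformlyComputableReal_ratRadius Computable.snd).lowerCE_neg.lt (hr.comp Computable.fst)
  have hB : UniformlyCEOpen fun t : α × (ℕ × ℕ × ℕ) => ratBall Y t.2 :=
    uniformlyCEOpen_ratBall.comp Computable.snd
  refine hB.of_exists (h1.and h2) fun a x => ⟨fun hx => ?_, ?_⟩
  · obtain ⟨b, hb, h3, h4⟩ := exists_ratRadius_btwn dist_nonneg (Metric.mem_ball.1 hx) (i a)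
    refine ⟨b, ⟨hb, h4⟩, ?_⟩
    rw [mem_ratBall, hb]
    exact h3
  · rintro ⟨b, ⟨hb, h3⟩, hx⟩
    rw [mem_ratBall, hb] at hx
    exact hx.trans h3

/-- By the triangle inequality a rational ball misses the closed ball once the distance of centres
minus its radius exceeds `r`; upper bounds for `r` suffice to see this. -/
theorem uniformlyCEOpen_compl_closedBall {i : α → ℕ} (hi : Computable i) {r : α → ℝ}
    (hr : LowerCE fun a => -r a) :
    UniformlyCEOpen fun a => (Metric.closedBall (pt (i a) : Y) (r a))ᶜ := by
  have h2 : REPred fun t : α × (ℕ × ℕ × ℕ) =>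
      r t.1 < dist (pt t.2.1 : Y) (pt (i t.1)) - ratRadius t.2 :=
    (hr.comp Computable.fst).lt
      ((uniformlyComputableReal_dist_pt Y (Computable.fst.comp Computable.snd)
        (hi.comp Computable.fst)).sub
          (uniformlyComputableReal_ratRadius Computable.snd)).lowerCE
  have hB : UniformlyCEOpen fun t : α × (ℕ × ℕ × ℕ) => ratBall Y t.2 :=
    uniformlyCEOpen_ratBall.comp Computable.snd
  refine hB.of_exists h2 fun a x => ⟨fun hx => ?_, ?_⟩
  · rw [Set.mem_compl_iff, Metric.mem_closedBall, not_le] at hx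
    obtain ⟨b, hb, hlt⟩ := exists_small_ratBall Y x (half_pos (sub_pos.2 hx))
    refine ⟨b, ?_, hb⟩
    have h5 := dist_triangle x (pt b.1 : Y) (pt (i a))
    have h6 := mem_ratBall.1 hb
    dsimp only
    linarith
  · rintro ⟨b, h3, hx⟩
    rw [Set.mem_compl_iff, Metric.mem_closedBall, not_le]
    have h5 := dist_triangle_left (pt b.1 : Y) (pt (i a)) x
    have h6 := mem_ratBall.1 hx
    dsimp only at h3
    linarith

/-- A uniformly c.e. open family is given by computable sequences of rational balls. -/
theorem UniformlyCEOpen.exists_computable_seq {U : α → Set Y} (hU : UniformlyCEOpen U) :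
    ∃ e : α × ℕ → ℕ × ℕ × ℕ, Computable e ∧ ∀ a, U a = ⋃ j, ratBall Y (e (a, j)) := by
  obtain ⟨W, hW, h⟩ := hU
  obtain ⟨f, hf, hfW⟩ := rePred_iff_exists_computable.1 hW
  let d : ℕ → (ℕ × ℕ × ℕ) × ℕ := Denumerable.ofNat _
  have hd : Computable fun t : α × ℕ => d t.2 := (Computable.ofNat _).comp Computable.snd
  -- Unsuccessful stages output `(0, 0, 0)`, the code of an empty ball.
  refine ⟨fun t => bif f ((t.1, (d t.2).1), (d t.2).2) then (d t.2).1 else (0, 0, 0),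
    Computable.cond (hf.comp ((Computable.fst.pair (Computable.fst.comp hd)).pair
      (Computable.snd.comp hd))) (Computable.fst.comp hd) (Computable.const _), fun a => ?_⟩
  have hempty : ratBall Y (0, 0, 0) = ∅ := by simp [ratBall]
  ext x
  simp only [h, Set.mem_iUnion, Set.mem_ofPred_eq, exists_prop, hfW]
  constructor
  · rintro ⟨b, ⟨s, hs⟩, hx⟩
    refine ⟨Encodable.encode (b, s), ?_⟩
    simpa only [d, Denumerable.ofNat_encode, hs, cond_true] using hx
  · rintro ⟨n, hn⟩
    cases hc : f ((a, (d n).1), (d n).2) with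
    | false => simp [hc, hempty] at hn
    | true => exact ⟨(d n).1, ⟨(d n).2, hc⟩, by simpa [hc] using hn⟩

/-- Other index types reduce to `ℕ` by encoding, with the empty set at numbers that code nothing. -/
theorem IsComputableMeasure.lowerCE [MeasurableSpace Y] {ν : Measure Y}
    (hν : IsComputableMeasure ν) {U : α → Set Y} (hU : UniformlyCEOpen U) :
    LowerCE fun a => ν.real (U a) := by
  have h1 : UniformlyCEOpen fun t : ℕ × α => U t.2 := hU.comp Computable.snd
  have h2 : UniformlyCEOpen fun n : ℕ => {x | ∃ a, Encodable.encode a = n ∧ x ∈ U a} :=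
    h1.of_exists (R := fun t => Encodable.encode t.2 = t.1)
      (REPred.of_primrecPred (Primrec.eq.comp (.comp .encode .snd) .fst)) (by simp)
  have h3 := ((hν _ h2).lowerCE fun _ => measureReal_nonneg).comp (Computable.encode (α := α))
  simpa using h3

end CEOpen

-- Computable radii with null spheres.

section NullSpheres

variable {Y : Type*} [MetricSpace Y] [MeasurableSpace Y] [BorelSpace Y]

open Filter Topology in
/-- Every interval contains small rational intervals of radii whose annulus around a given centre
has small measure. -/
theorem exists_ratVal_annulus (ν : Measure Y) [IsProbabilityMeasure ν] (c : Y)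
    {lo hi ε : ℝ} (h : lo < hi) (hε : 0 < ε) :
    ∃ s : ℕ × ℕ × ℕ, lo < ratVal s ∧ ratVal (s.1 + 1, s.2) < hi ∧
      ratVal (s.1 + 1, s.2) < ratVal s + ε ∧
      1 - ε < ν.real (Metric.ball c (ratVal s) ∪
        (Metric.closedBall c (ratVal (s.1 + 1, s.2)))ᶜ) := by
  have hm : Measurable fun x : Y => dist x c := (continuous_id.dist continuous_const).measurable
  -- Disjoint spheres of positive measure are countably many, so some radius in the interval has a
  -- null sphere.
  obtain ⟨t, ⟨ht1, ht2⟩, ht⟩ : ∃ t ∈ Set.Ioo lo hi, ν {x | dist x c = t} = 0 := by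
    have hc := Measure.countable_meas_level_set_pos (μ := ν) hm
    obtain ⟨t, ht, ht'⟩ := (hc.dense_compl ℝ).exists_mem_open isOpen_Ioo (Set.nonempty_Ioo.2 h)
    exact ⟨t, ht', by simpa using ht⟩
  -- Annuli around this sphere are preimages of thickenings of `{t}`, so their measures tend to `0`.
  have hlim := tendsto_measure_cthickening_of_isClosed (μ := ν.map fun x => dist x c)
    (s := {t}) ⟨1, one_pos, measure_ne_top _ _⟩ isClosed_singleton
  have h0 : (ν.map fun x => dist x c) {t} = 0 := by
    rw [Measure.map_apply hm (measurableSet_singleton t)]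
    exact ht
  rw [h0] at hlim
  have hev := hlim.eventually_lt_const (ENNReal.ofReal_pos.2 hε)
  obtain ⟨δ, hδ, hδs⟩ := Metric.eventually_nhds_iff.1 hev
  obtain ⟨w, hw⟩ := exists_nat_one_div_lt
    (lt_min (half_pos hδ) (lt_min hε (lt_min (sub_pos.2 ht1) (sub_pos.2 ht2))))
  simp only [lt_min_iff] at hw
  obtain ⟨hw1, hw2, hw3, hw4⟩ := hw
  have hw0 : (0 : ℝ) < w + 1 := by positivity
  -- The triple `s` stands for the interval from `ratVal s` to `ratVal (s.1 + 1, s.2)`, here the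
  -- cell containing `t` of the grid of mesh `1 / (w + 1)`.
  set z : ℤ := ⌊t * (w + 1)⌋ with hz
  set s : ℕ × ℕ × ℕ := (z.toNat, (-z).toNat, w) with hs
  have hz1 : ((z.toNat : ℝ) - (-z).toNat) = z := by
    exact_mod_cast Int.toNat_sub_toNat_neg z
  have hsucc : ratVal (s.1 + 1, s.2) = ratVal s + 1 / (w + 1) := by
    simp only [ratVal, hs]
    push_cast
    ring
  have hlo : ratVal s ≤ t := by
    simp only [ratVal, hs, hz1]
    rw [div_le_iff₀ hw0]
    exact Int.floor_le _
  have hhi : t < ratVal s + 1 / (w + 1) := by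
    simp only [ratVal, hs, hz1]
    rw [← add_div, lt_div_iff₀ hw0]
    exact Int.lt_floor_add_one _
  refine ⟨s, by linarith, by rw [hsucc]; linarith, by rw [hsucc]; linarith, ?_⟩
  rw [hsucc]
  have hsub : (Metric.ball c (ratVal s) ∪ (Metric.closedBall c (ratVal s + 1 / (w + 1)))ᶜ)ᶜ ⊆
      (fun x => dist x c) ⁻¹' (Metric.cthickening (δ / 2) {t}) := by
    intro x hx
    simp only [Set.mem_compl_iff, Set.mem_union, not_or, not_not, Metric.mem_ball, not_lt,
      Metric.mem_closedBall] at hx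
    rw [Set.mem_preimage, Metric.cthickening_singleton _ (half_pos hδ).le, Metric.mem_closedBall,
      Real.dist_eq, abs_le]
    constructor <;> linarith [hx.1, hx.2]
  have hsmall : ν.real (Metric.ball c (ratVal s) ∪
      (Metric.closedBall c (ratVal s + 1 / (w + 1)))ᶜ)ᶜ < ε := by
    refine (measureReal_mono hsub).trans_lt ?_
    have h1 := hδs (y := δ / 2) (by
      rw [Real.dist_eq, sub_zero, abs_of_pos (half_pos hδ)]
      exact half_lt_self hδ)
    rw [Measure.map_apply hm Metric.isClosed_cthickening.measurableSet] at h1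
    exact (ENNReal.lt_ofReal_iff_toReal_lt (measure_ne_top _ _)).1 h1
  have hmeas : MeasurableSet (Metric.ball c (ratVal s) ∪
      (Metric.closedBall c (ratVal s + 1 / (w + 1)))ᶜ) :=
    Metric.isOpen_ball.measurableSet.union Metric.isClosed_closedBall.measurableSet.compl
  rw [probReal_compl_eq_one_sub hmeas] at hsmall
  linarith

theorem ratVal_lt_ratVal_succ (s : ℕ × ℕ × ℕ) : ratVal s < ratVal (s.1 + 1, s.2) := by
  simp only [ratVal]
  refine div_lt_div_of_pos_right ?_ (by positivity)
  push_cast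
  linarith

theorem uniformlyComputableReal_ratVal_succ {α : Type*} [Primcodable α] {c : α → ℕ × ℕ × ℕ}
    (hc : Computable c) : UniformlyComputableReal fun a => ratVal ((c a).1 + 1, (c a).2) :=
  uniformlyComputableReal_ratVal ((Computable.succ.comp (Computable.fst.comp hc)).pair
    (Computable.snd.comp hc))

variable [ComputablePolishSpace Y]

open ComputablePolishSpace

/-- Uniformly in a centre and a rational interval one can compute a nested sequence of rational
intervals of radii whose annuli around the centre have measures tending to `0`. -/
theorem IsComputableMeasure.exists_nested_intervals {ν : Measure Y} [IsProbabilityMeasure ν]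
    (hν : IsComputableMeasure ν) :
    ∃ F : (ℕ × (ℕ × ℕ × ℕ)) × ℕ → ℕ × ℕ × ℕ, Computable F ∧ (∀ a, F (a, 0) = a.2) ∧
      ∀ a k, ratVal (F (a, k)) < ratVal (F (a, k + 1)) ∧
        ratVal ((F (a, k + 1)).1 + 1, (F (a, k + 1)).2) <
          ratVal ((F (a, k)).1 + 1, (F (a, k)).2) ∧
        ratVal ((F (a, k + 1)).1 + 1, (F (a, k + 1)).2) < ratVal (F (a, k + 1)) + (1 / 2) ^ k ∧
        1 - (1 / 2) ^ k < ν.real (Metric.ball (pt a.1) (ratVal (F (a, k + 1))) ∪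
          (Metric.closedBall (pt a.1) (ratVal ((F (a, k + 1)).1 + 1, (F (a, k + 1)).2)))ᶜ) := by
  have ci : Computable fun t : (ℕ × ℕ × (ℕ × ℕ × ℕ)) × (ℕ × ℕ × ℕ) => t.1.1 := .comp .fst .fst
  have ck : Computable fun t : (ℕ × ℕ × (ℕ × ℕ × ℕ)) × (ℕ × ℕ × ℕ) => t.1.2.1 :=
    .comp .fst (.comp .snd .fst)
  have cs : Computable fun t : (ℕ × ℕ × (ℕ × ℕ × ℕ)) × (ℕ × ℕ × ℕ) => t.1.2.2 :=
    .comp .snd (.comp .snd .fst)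
  have cs' : Computable fun t : (ℕ × ℕ × (ℕ × ℕ × ℕ)) × (ℕ × ℕ × ℕ) => t.2 := .snd
  have hpow := uniformlyComputableReal_half_pow ck
  -- The smallness of the closed annulus is phrased through its c.e. open complement, whose measure
  -- can be bounded below effectively.
  have hopen := hν.lowerCE
    ((uniformlyCEOpen_ball (Y := Y) ci (uniformlyComputableReal_ratVal cs').lowerCE).union
      (uniformlyCEOpen_compl_closedBall (Y := Y) ci (uniformlyComputableReal_ratVal_succ cs').lowerCE_neg))
  have hR := ((uniformlyComputableReal_ratVal cs).lt (uniformlyComputableReal_ratVal cs')).and (((uniformlyComputableReal_ratVal_succ cs').lt (uniformlyComputableReal_ratVal_succ cs)).and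
    (((uniformlyComputableReal_ratVal_succ cs').lt ((uniformlyComputableReal_ratVal cs').add hpow)).and
      ((uniformlyComputableReal_one.sub hpow).lowerCE_neg.lt hopen)))
  obtain ⟨g, hg, hgs⟩ := hR.exists_computable_choice (by
    rintro ⟨i, k, s⟩
    have h := exists_ratVal_annulus ν (pt i : Y) (ratVal_lt_ratVal_succ s)
      (pow_pos (by norm_num : (0 : ℝ) < 1 / 2) k)
    exact h)
  let F : (ℕ × (ℕ × ℕ × ℕ)) × ℕ → ℕ × ℕ × ℕ := fun t =>
    Nat.rec t.1.2 (fun k s => g (t.1.1, k, s)) t.2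
  have hF : Computable F := by
    refine Computable.nat_rec (f := fun t : (ℕ × (ℕ × ℕ × ℕ)) × ℕ => t.2)
      (g := fun t => t.1.2) (h := fun t u => g (t.1.1, u.1, u.2)) .snd (.comp .snd .fst) ?_
    exact hg.comp ((Computable.fst.comp (Computable.fst.comp Computable.fst)).pair
      ((Computable.fst.comp Computable.snd).pair (Computable.snd.comp Computable.snd)))
  exact ⟨F, hF, fun a => rfl, fun a k => hgs (a.1, k, F (a, k))⟩

/-- Uniformly in a centre and a rational interval one can compute a radius in the interval whose
sphere is a null set. -/
theorem IsComputableMeasure.exists_null_radius {ν : Measure Y} [IsProbabilityMeasure ν]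
    (hν : IsComputableMeasure ν) :
    ∃ r : ℕ × (ℕ × ℕ × ℕ) → ℝ, UniformlyComputableReal r ∧ ∀ i s,
      ratVal s < r (i, s) ∧ r (i, s) < ratVal (s.1 + 1, s.2) ∧
      ν.real (Metric.closedBall (pt i) (r (i, s)) \ Metric.ball (pt i) (r (i, s))) = 0 := by
  obtain ⟨F, hF, hF0, hstep⟩ := hν.exists_nested_intervals
  have hmono : ∀ a, StrictMono fun k => ratVal (F (a, k)) := fun a =>
    strictMono_nat_of_lt_succ fun k => (hstep a k).1
  have hanti : ∀ a, StrictAnti fun k => ratVal ((F (a, k)).1 + 1, (F (a, k)).2) := fun a =>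
    strictAnti_nat_of_succ_lt fun k => (hstep a k).2.1
  have hcross : ∀ a k m, ratVal (F (a, k)) < ratVal ((F (a, m)).1 + 1, (F (a, m)).2) := fun a k m =>
    ((hmono a).monotone (le_max_left k m)).trans_lt
      ((ratVal_lt_ratVal_succ _).trans_le ((hanti a).antitone (le_max_right k m)))
  -- The common point of the nested intervals: left endpoints approximate it from below, right
  -- endpoints from above.
  let r : ℕ × (ℕ × ℕ × ℕ) → ℝ := fun a => ⨆ k, ratVal (F (a, k))
  have hbdd : ∀ a, BddAbove (Set.range fun k => ratVal (F (a, k))) := fun a =>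
    ⟨ratVal ((F (a, 0)).1 + 1, (F (a, 0)).2), by rintro _ ⟨k, rfl⟩; exact (hcross a k 0).le⟩
  have hle : ∀ a k, ratVal (F (a, k)) ≤ r a := fun a k => le_ciSup (hbdd a) k
  have hge : ∀ a k, r a ≤ ratVal ((F (a, k)).1 + 1, (F (a, k)).2) := fun a k => ciSup_le fun m => (hcross a m k).le
  refine ⟨r, uniformlyComputableReal_iff.2 ⟨?_, ?_⟩, fun i s => ⟨?_, ?_, ?_⟩⟩
  · exact LowerCE.of_sup (uniformlyComputableReal_ratVal hF).lowerCE hle fun a c hc => exists_lt_of_lt_ciSup hc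
  · refine LowerCE.of_sup (uniformlyComputableReal_ratVal_succ hF).lowerCE_neg (fun a k => neg_le_neg (hge a k)) ?_
    intro a c hc
    obtain ⟨k, hk⟩ := exists_pow_lt_of_lt_one (sub_pos.2 hc) (by norm_num : (1 / 2 : ℝ) < 1)
    refine ⟨k + 1, ?_⟩
    have h1 := (hstep a k).2.2.1
    have h2 := hle a (k + 1)
    linarith
  · have h := (hstep (i, s) 0).1.trans_le (hle (i, s) 1)
    rwa [hF0] at h
  · have h := (hge (i, s) 1).trans_lt (hstep (i, s) 0).2.1
    rwa [hF0] at h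
  · refine le_antisymm (le_of_forall_pos_le_add fun ε hε => ?_) measureReal_nonneg
    obtain ⟨k, hk⟩ := exists_pow_lt_of_lt_one hε (by norm_num : (1 / 2 : ℝ) < 1)
    have h1 := (hstep (i, s) k).2.2.2
    have hmeas : MeasurableSet (Metric.ball (pt i : Y) (ratVal (F ((i, s), k + 1))) ∪
        (Metric.closedBall (pt i) (ratVal ((F ((i, s), k + 1)).1 + 1, (F ((i, s), k + 1)).2)))ᶜ) :=
      Metric.isOpen_ball.measurableSet.union Metric.isClosed_closedBall.measurableSet.compl
    have h2 := probReal_compl_eq_one_sub (μ := ν) hmeas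
    have h3 : Metric.closedBall (pt i : Y) (r (i, s)) \ Metric.ball (pt i) (r (i, s)) ⊆
        (Metric.ball (pt i : Y) (ratVal (F ((i, s), k + 1))) ∪
        (Metric.closedBall (pt i) (ratVal ((F ((i, s), k + 1)).1 + 1, (F ((i, s), k + 1)).2)))ᶜ)ᶜ := by
      intro x hx
      simp only [Set.mem_sdiff, Metric.mem_closedBall, Metric.mem_ball, not_lt] at hx
      simp only [Set.mem_compl_iff, Set.mem_union, not_or, not_not, Metric.mem_ball, not_lt,
        Metric.mem_closedBall]
      exact ⟨(hle _ _).trans hx.2, hx.1.trans (hge _ _)⟩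
    have h4 := measureReal_mono (μ := ν) h3
    linarith

end NullSpheres

-- Measure estimates for countable unions.

section MeasureEstimates

variable {Ω : Type*} [MeasurableSpace Ω]

open Filter Topology in
theorem tendsto_measureReal_iUnion_lt (ν : Measure Ω) [IsFiniteMeasure ν] (A : ℕ → Set Ω) :
    Tendsto (fun k => ν.real (⋃ j < k, A j)) atTop (𝓝 (ν.real (⋃ j, A j))) := by
  have hmono : Monotone fun k => ⋃ j < k, A j := fun k l hkl =>
    Set.biUnion_subset_biUnion_left fun j (hj : j < k) => lt_of_lt_of_le hj hkl
  have h := tendsto_measure_iUnion_atTop (μ := ν) hmono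
  have heq : (⋃ k, ⋃ j < k, A j) = ⋃ j, A j := by
    ext x
    simp only [Set.mem_iUnion, exists_prop]
    exact ⟨fun ⟨k, j, _, hx⟩ => ⟨j, hx⟩, fun ⟨j, hx⟩ => ⟨j + 1, j, j.lt_succ_self, hx⟩⟩
  rw [heq] at h
  exact (ENNReal.tendsto_toReal (measure_ne_top _ _)).comp h

theorem measureReal_iUnion_le_half_pow (ν : Measure Ω) [IsFiniteMeasure ν] {T : ℕ → Set Ω} {m : ℕ}
    (hT : ∀ i, ν.real (T i) ≤ (1 / 2 : ℝ) ^ (m + i + 1)) :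
    ν.real (⋃ i, T i) ≤ (1 / 2 : ℝ) ^ m := by
  have hsum : HasSum (fun i : ℕ => (1 / 2 : ℝ) ^ (m + i + 1)) ((1 / 2) ^ m) := by
    have h := hasSum_geometric_two.mul_left ((1 / 2 : ℝ) ^ (m + 1))
    have h2 : (1 / 2 : ℝ) ^ (m + 1) * 2 = (1 / 2) ^ m := by
      rw [pow_succ]
      ring
    rw [h2] at h
    refine h.congr_fun ?_
    intro i
    rw [← pow_add]
    congr 1
    ring
  refine ENNReal.toReal_le_of_le_ofReal (by positivity) ?_
  calc ν (⋃ i, T i) ≤ ∑' i, ν (T i) := measure_iUnion_le _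
    _ ≤ ∑' i, ENNReal.ofReal ((1 / 2 : ℝ) ^ (m + i + 1)) := ENNReal.tsum_le_tsum fun i => by
        rw [ENNReal.le_ofReal_iff_toReal_le (measure_ne_top _ _) (by positivity)]
        exact hT i
    _ = ENNReal.ofReal ((1 / 2 : ℝ) ^ m) := by
        rw [← ENNReal.ofReal_tsum_of_nonneg (fun i => by positivity) hsum.summable, hsum.tsum_eq]

/-- Upper bound for the measure of a union of approximations `G i` from outside of sets `C i`. -/
theorem measureReal_iUnion_le_of_approx (ν : Measure Ω) [IsFiniteMeasure ν]
    {G H C : ℕ → Set Ω} (hC : ∀ i, MeasurableSet (C i))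
    (hCG : ∀ i, C i ⊆ G i) (hG : ∀ i, ν.real (G i \ C i) ≤ (1 / 2 : ℝ) ^ (i + 1)) (M : ℕ)
    (hH : ∀ i, ν.real (H i \ C i) ≤ (1 / 2 : ℝ) ^ (2 * M)) :
    ν.real (⋃ i, G i) ≤ ν.real (⋃ i < M, G i) + (ν.real (⋃ i, C i) - ν.real (⋃ i < M, H i)) +
      ((1 / 2 : ℝ) ^ M + (1 / 2 : ℝ) ^ M) := by
  have hsub : (⋃ i < M, C i) ⊆ ⋃ i, C i := Set.iUnion₂_subset fun i _ => Set.subset_iUnion C i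
  have hmeas : MeasurableSet (⋃ i < M, C i) :=
    MeasurableSet.iUnion fun i => MeasurableSet.iUnion fun _ => hC i
  -- A point of the union lies in an early `G i`, in a late `C i` but no early one, or in the excess
  -- of a late `G i`.
  have h1 : (⋃ i, G i) ⊆ ((⋃ i < M, G i) ∪ ((⋃ i, C i) \ ⋃ i < M, C i)) ∪
      ⋃ i, (G (M + i) \ C (M + i)) := by
    intro x hx
    obtain ⟨i, hi⟩ := Set.mem_iUnion.1 hx
    rcases lt_or_ge i M with hM | hM
    · exact Or.inl (Or.inl (Set.mem_biUnion hM hi))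
    by_cases hxC : x ∈ C i
    · by_cases hxM : x ∈ ⋃ i < M, C i
      · exact Or.inl (Or.inl (Set.iUnion₂_mono (fun i _ => hCG i) hxM))
      · exact Or.inl (Or.inr ⟨Set.mem_iUnion.2 ⟨i, hxC⟩, hxM⟩)
    · obtain ⟨k, rfl⟩ := Nat.exists_eq_add_of_le hM
      exact Or.inr (Set.mem_iUnion.2 ⟨k, hi, hxC⟩)
  have h2 : ν.real (⋃ i, (G (M + i) \ C (M + i))) ≤ (1 / 2 : ℝ) ^ M :=
    measureReal_iUnion_le_half_pow ν fun i => hG (M + i)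
  -- Passing from `C` to `H` costs at most `M * 2 ^ (-2 * M)`, which is at most `2 ^ (-M)`.
  have h3 : ν.real (⋃ i < M, H i) ≤ ν.real (⋃ i < M, C i) + (1 / 2 : ℝ) ^ M := by
    have h4 : (⋃ i < M, H i) ⊆ (⋃ i < M, C i) ∪ ⋃ i ∈ Finset.range M, (H i \ C i) := by
      intro x hx
      simp only [Set.mem_iUnion, exists_prop] at hx
      obtain ⟨i, hi, hxi⟩ := hx
      by_cases hxC : x ∈ C i
      · exact Or.inl (Set.mem_biUnion hi hxC)
      · exact Or.inr (Set.mem_biUnion (Finset.mem_coe.2 (Finset.mem_range.2 hi)) ⟨hxi, hxC⟩)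
    have h5 : ν.real (⋃ i ∈ Finset.range M, (H i \ C i)) ≤ (1 / 2 : ℝ) ^ M := by
      calc ν.real (⋃ i ∈ Finset.range M, (H i \ C i))
          ≤ ∑ i ∈ Finset.range M, ν.real (H i \ C i) := measureReal_biUnion_finset_le _ _
        _ ≤ ∑ _i ∈ Finset.range M, (1 / 2 : ℝ) ^ (2 * M) := Finset.sum_le_sum fun i _ => hH i
        _ = (M * (1 / 2 : ℝ) ^ M) * (1 / 2 : ℝ) ^ M := by
            rw [Finset.sum_const, Finset.card_range, nsmul_eq_mul, two_mul, pow_add, mul_assoc]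
        _ ≤ 1 * (1 / 2 : ℝ) ^ M := by
            refine mul_le_mul_of_nonneg_right ?_ (by positivity)
            rw [one_div_pow, mul_one_div, div_le_one (by positivity)]
            exact_mod_cast Nat.lt_two_pow_self.le
        _ = (1 / 2 : ℝ) ^ M := one_mul _
    exact (measureReal_mono h4).trans ((measureReal_union_le _ _).trans (by linarith))
  have h6 := measureReal_sdiff (μ := ν) hsub hmeas
  have h7 := measureReal_mono (μ := ν) h1
  have h8 := measureReal_union_le (μ := ν) ((⋃ i < M, G i) ∪ ((⋃ i, C i) \ ⋃ i < M, C i))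
    (⋃ i, (G (M + i) \ C (M + i)))
  have h9 := measureReal_union_le (μ := ν) (⋃ i < M, G i) ((⋃ i, C i) \ ⋃ i < M, C i)
  linarith

end MeasureEstimates

-- Almost decidable sets.

section AlmostDecidable

variable {α β : Type*} [Primcodable α] [Primcodable β]
variable {Y : Type*} [MetricSpace Y] [ComputablePolishSpace Y] [MeasurableSpace Y]

open ComputablePolishSpace

theorem UniformlyEffectivelyClosed.measurableSet [BorelSpace Y] {C : α → Set Y}
    (hC : UniformlyEffectivelyClosed C) (a : α) : MeasurableSet (C a) := by
  rw [← compl_compl (C a)]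
  exact (UniformlyCEOpen.isOpen hC a).measurableSet.compl

/-- Uniformly almost decidable families: c.e. open sets `A a` inside effectively closed sets `A' a`
with null difference. -/
structure AlmostDecidable (ν : Measure Y) (A A' : α → Set Y) : Prop where
  ceOpen : UniformlyCEOpen A
  effClosed : UniformlyEffectivelyClosed A'
  subset : ∀ a, A a ⊆ A' a
  null : ∀ a, ν.real (A' a \ A a) = 0

namespace AlmostDecidable

variable {ν : Measure Y}

theorem comp {A A' : β → Set Y} (h : AlmostDecidable ν A A') {f : α → β} (hf : Computable f) :
    AlmostDecidable ν (fun a => A (f a)) fun a => A' (f a) :=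
  ⟨h.ceOpen.comp hf, UniformlyCEOpen.comp h.effClosed hf, fun _ => h.subset _, fun _ => h.null _⟩

theorem compl {A A' : α → Set Y} (h : AlmostDecidable ν A A') :
    AlmostDecidable ν (fun a => (A' a)ᶜ) fun a => (A a)ᶜ where
  ceOpen := h.effClosed
  effClosed := by simpa only [UniformlyEffectivelyClosed, compl_compl] using h.ceOpen
  subset a := Set.compl_subset_compl.2 (h.subset a)
  null a := by
    rw [← h.null a]
    congr 1
    ext x
    simp [and_comm]

theorem iUnion_lt [IsFiniteMeasure ν] {A A' : α × ℕ → Set Y} (h : AlmostDecidable ν A A') :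
    AlmostDecidable ν (fun t : α × ℕ => ⋃ j < t.2, A (t.1, j))
      fun t => ⋃ j < t.2, A' (t.1, j) where
  ceOpen := h.ceOpen.iUnion_lt
  effClosed := by
    simpa only [UniformlyEffectivelyClosed, Set.compl_iUnion] using
      UniformlyCEOpen.iInter_lt h.effClosed
  subset t := Set.iUnion₂_mono fun j _ => h.subset _
  null t := by
    have hnull : ν (⋃ j, A' (t.1, j) \ A (t.1, j)) = 0 :=
      measure_iUnion_null fun j => (measureReal_eq_zero_iff).1 (h.null _)
    rw [measureReal_eq_zero_iff]
    refine measure_mono_null ?_ hnull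
    rintro x ⟨hx, hx'⟩
    simp only [Set.mem_iUnion, not_exists, exists_prop, not_and] at hx hx'
    obtain ⟨j, hj, hxj⟩ := hx
    exact Set.mem_iUnion.2 ⟨j, hxj, hx' j hj⟩

theorem measureReal_eq [IsFiniteMeasure ν] {A A' : α → Set Y} (h : AlmostDecidable ν A A') (a : α) :
    ν.real (A' a) = ν.real (A a) := by
  refine le_antisymm ?_ (measureReal_mono (h.subset a))
  calc ν.real (A' a) ≤ ν.real (A a ∪ A' a \ A a) := measureReal_mono (by simp)
    _ ≤ ν.real (A a) + ν.real (A' a \ A a) := measureReal_union_le _ _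
    _ = ν.real (A a) := by rw [h.null, add_zero]

variable [BorelSpace Y] [IsProbabilityMeasure ν]

/-- Both `A` and the complement of `A'` are c.e. open, and their measures add up to `1`; lower
bounds for one are upper bounds for the other. -/
theorem computable_measureReal (hν : IsComputableMeasure ν) {A A' : α → Set Y}
    (h : AlmostDecidable ν A A') : UniformlyComputableReal fun a => ν.real (A a) := by
  refine uniformlyComputableReal_iff.2 ⟨hν.lowerCE h.ceOpen, ?_⟩
  have h1 := (hν.lowerCE h.effClosed).add
    (uniformlyComputableReal_one (α := α)).lowerCE_neg
  have h2 : ∀ a, ν.real (A' a)ᶜ + -1 = -ν.real (A a) := by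
    intro a
    rw [probReal_compl_eq_one_sub (h.effClosed.measurableSet a), h.measureReal_eq]
    ring
  simpa only [h2] using h1

end AlmostDecidable

variable [BorelSpace Y] {ν : Measure Y} [IsProbabilityMeasure ν]

/-- Every uniformly c.e. open family is exhausted by almost decidable balls. -/
theorem UniformlyCEOpen.exists_almostDecidable_seq (hν : IsComputableMeasure ν) {U : α → Set Y}
    (hU : UniformlyCEOpen U) : ∃ A A' : α × ℕ → Set Y, AlmostDecidable ν A A' ∧
      ∀ a, (U a = ⋃ j, A (a, j)) ∧ U a = ⋃ j, A' (a, j) := by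
  obtain ⟨e, he, heU⟩ := hU.exists_computable_seq
  obtain ⟨r, hr, hrs⟩ := hν.exists_null_radius
  -- For a ball of radius `p / (q + 1)` and precision `m`, this codes the interval of length `1 /
  -- ((q + 1) * (m + 1))` ending at that radius. Null radii chosen there stay below it, so even the
  -- closed balls lie in the given ball.
  let s : (ℕ × ℕ × ℕ) × ℕ → ℕ × ℕ × ℕ := fun t =>
    (t.1.2.1 * (t.2 + 1), 1, t.1.2.2 * (t.2 + 1) + t.2)
  have hs : Primrec s := by
    have h1 : Primrec fun t : (ℕ × ℕ × ℕ) × ℕ => t.1.2.1 := .comp .fst (.comp .snd .fst)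
    have h2 : Primrec fun t : (ℕ × ℕ × ℕ) × ℕ => t.1.2.2 := .comp .snd (.comp .snd .fst)
    have h3 : Primrec fun t : (ℕ × ℕ × ℕ) × ℕ => t.2 + 1 := .comp .succ .snd
    exact (Primrec.nat_mul.comp h1 h3).pair ((Primrec.const 1).pair
      (Primrec.nat_add.comp (Primrec.nat_mul.comp h2 h3) .snd))
  let c : α × ℕ → ℕ × ℕ × ℕ := fun t => e (t.1, t.2.unpair.1)
  have hun : Computable fun t : α × ℕ => t.2.unpair := Computable.unpair.comp Computable.snd
  have hc : Computable c := he.comp (Computable.fst.pair (Computable.fst.comp hun))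
  let ρ : α × ℕ → ℝ := fun t => r ((c t).1, s (c t, t.2.unpair.2))
  have hρ : UniformlyComputableReal ρ := hr.comp ((Computable.fst.comp hc).pair
    (hs.to_comp.comp (hc.pair (Computable.snd.comp hun))))
  have hhi : ∀ t, ρ t < ratRadius (c t) := by
    intro t
    refine (hrs (c t).1 (s (c t, t.2.unpair.2))).2.1.trans_eq ?_
    simp only [s, ratVal, ratRadius]
    push_cast
    field_simp
    ring
  have hlo : ∀ t, ratRadius (c t) - 1 / (t.2.unpair.2 + 1) < ρ t := by
    intro t
    refine lt_of_le_of_lt ?_ (hrs (c t).1 (s (c t, t.2.unpair.2))).1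
    have : ratVal (s (c t, t.2.unpair.2)) = ratRadius (c t) -
        1 / (((c t).2.2 + 1) * (t.2.unpair.2 + 1)) := by
      simp only [s, ratVal, ratRadius]
      push_cast
      field_simp
      ring
    rw [this]
    refine sub_le_sub_left (one_div_le_one_div_of_le (by positivity) ?_) _
    exact le_mul_of_one_le_left (by positivity) (by simp)
  have hin : ∀ a, U a ⊆ ⋃ j, Metric.ball (pt (c (a, j)).1 : Y) (ρ (a, j)) := by
    intro a x hx
    rw [heU, Set.mem_iUnion] at hx
    obtain ⟨j, hj⟩ := hx
    obtain ⟨m, hm⟩ := exists_nat_one_div_lt (sub_pos.2 (mem_ratBall.1 hj))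
    refine Set.mem_iUnion.2 ⟨Nat.pair j m, ?_⟩
    have h1 := hlo (a, Nat.pair j m)
    simp only [c, Nat.unpair_pair] at h1
    simp only [Metric.mem_ball, c, Nat.unpair_pair]
    linarith
  have hout : ∀ a, (⋃ j, Metric.closedBall (pt (c (a, j)).1 : Y) (ρ (a, j))) ⊆ U a := by
    intro a x hx
    obtain ⟨j, hj⟩ := Set.mem_iUnion.1 hx
    rw [heU]
    exact Set.mem_iUnion.2 ⟨_, (Metric.mem_closedBall.1 hj).trans_lt (hhi (a, j))⟩
  have hsub : ∀ a, (⋃ j, Metric.ball (pt (c (a, j)).1 : Y) (ρ (a, j))) ⊆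
      ⋃ j, Metric.closedBall (pt (c (a, j)).1 : Y) (ρ (a, j)) :=
    fun a => Set.iUnion_mono fun j => Metric.ball_subset_closedBall
  refine ⟨fun t => Metric.ball (pt (c t).1) (ρ t), fun t => Metric.closedBall (pt (c t).1) (ρ t),
    ⟨uniformlyCEOpen_ball (Computable.fst.comp hc) hρ.lowerCE,
      uniformlyCEOpen_compl_closedBall (Computable.fst.comp hc) hρ.lowerCE_neg,
      fun t => Metric.ball_subset_closedBall, fun t => (hrs _ _).2.2⟩, fun a => ⟨?_, ?_⟩⟩
  · exact (hin a).antisymm ((hsub a).trans (hout a))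
  · exact ((hin a).trans (hsub a)).antisymm (hout a)

/-- An effectively closed set of computable measure can be approximated from outside by
almost decidable sets, effectively in measure. -/
theorem UniformlyEffectivelyClosed.exists_almostDecidable_superset (hν : IsComputableMeasure ν)
    {C : α → Set Y} (hC : UniformlyEffectivelyClosed C)
    (hm : UniformlyComputableReal fun a => ν.real (C a)) :
    ∃ G G' : α × ℕ → Set Y, AlmostDecidable ν G G' ∧
      ∀ a l, C a ⊆ G (a, l) ∧ ν.real (G (a, l) \ C a) ≤ (1 / 2 : ℝ) ^ l := by
  obtain ⟨A, A', hA, hAC⟩ := UniformlyCEOpen.exists_almostDecidable_seq hν hC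
  have hE := hA.iUnion_lt
  -- Finite unions of almost decidable balls have computable measure, so one can search for a union
  -- filling the complement of `C` up to `2 ^ (-l)`; its complement becomes `G`.
  have hR : REPred fun t : (α × ℕ) × ℕ =>
      1 - ν.real (C t.1.1) - (1 / 2 : ℝ) ^ t.1.2 < ν.real (⋃ j < t.2, A (t.1.1, j)) := by
    have h1 := (uniformlyComputableReal_one.sub
      (hm.comp (Computable.fst.comp Computable.fst))).sub (uniformlyComputableReal_half_pow
        (Computable.snd.comp (Computable.fst (α := α × ℕ) (β := ℕ))))
    have h2 := (hE.computable_measureReal hν).comp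
      ((Computable.fst.comp (Computable.fst (α := α × ℕ) (β := ℕ))).pair Computable.snd)
    exact h1.lt h2
  obtain ⟨K, hK, hKs⟩ := hR.exists_computable_choice (by
    rintro ⟨a, l⟩
    have h1 := tendsto_measureReal_iUnion_lt ν fun j => A (a, j)
    rw [← (hAC a).1, probReal_compl_eq_one_sub (hC.measurableSet a)] at h1
    have hpos : (0 : ℝ) < (1 / 2) ^ l := by positivity
    exact (h1.eventually_const_lt (sub_lt_self _ hpos)).exists)
  have hG := (hE.comp (Computable.fst.pair hK)).compl
  have hsub : ∀ a l, C a ⊆ (⋃ j < K (a, l), A' (a, j))ᶜ := by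
    intro a l
    rw [Set.subset_compl_comm, (hAC a).2]
    exact Set.iUnion₂_subset fun j _ => Set.subset_iUnion (fun j => A' (a, j)) j
  refine ⟨_, _, hG, fun a l => ⟨hsub a l, ?_⟩⟩
  have h1 := hKs (a, l)
  have h2 := hG.measureReal_eq (a, l)
  have h3 := probReal_compl_eq_one_sub (μ := ν) (hE.ceOpen.isOpen (a, K (a, l))).measurableSet
  dsimp only at h1 h2 h3 ⊢
  rw [measureReal_sdiff (hsub a l) (hC.measurableSet a)]
  linarith

end AlmostDecidable

-- Schnorr tests and `Σ⁰₂` tests.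

section Schnorr

variable {Y : Type*} [MetricSpace Y] [ComputablePolishSpace Y] [MeasurableSpace Y] [BorelSpace Y]
variable {ν : Measure Y} [IsProbabilityMeasure ν]

/-- A c.e. open family with computable measures is a family of effectively `Σ⁰₂` sets. -/
theorem UniformlyCEOpen.uniformlyEffectiveSigma02 {α : Type*} [Primcodable α]
    (hν : IsComputableMeasure ν) {U : α → Set Y} (hU : UniformlyCEOpen U)
    (hm : UniformlyComputableReal fun a => ν.real (U a)) : UniformlyEffectiveSigma02 ν U := by
  obtain ⟨A, A', hA, hAU⟩ := hU.exists_almostDecidable_seq hν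
  refine ⟨hm, fun a j => A' (a, j), hA.effClosed, ?_, fun a => (hAU a).2⟩
  simpa only [hA.measureReal_eq] using hA.computable_measureReal hν

open Filter Topology in
/-- Every test of effectively `Σ⁰₂` sets is covered by a Schnorr test. -/
theorem UniformlyEffectiveSigma02.exists_schnorrTest (hν : IsComputableMeasure ν)
    {B : ℕ → Set Y} (hB : UniformlyEffectiveSigma02 ν B)
    (hle : ∀ n, ν.real (B n) ≤ (1 / 2 : ℝ) ^ n) :
    ∃ U : ℕ → Set Y, IsSchnorrTest ν U ∧ ∀ n, B (n + 1) ⊆ U n := by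
  obtain ⟨hBm, C, hC, hCm, hBC⟩ := hB
  obtain ⟨G, G', hG, hGC⟩ := hC.exists_almostDecidable_superset hν hCm
  have hCmeas : ∀ n i, MeasurableSet (C n i) := fun n i => hC.measurableSet (n, i)
  -- The excesses `2 ^ (-(n + i + 2))` sum to `2 ^ (-(n + 1))`; with the bound for `B (n + 1)` this
  -- makes `2 ^ (-n)`, which explains the shift of index.
  let V : ℕ × ℕ → Set Y := fun t => G ((t.1 + 1, t.2), t.1 + t.2 + 2)
  let V' : ℕ × ℕ → Set Y := fun t => G' ((t.1 + 1, t.2), t.1 + t.2 + 2)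
  have hV : AlmostDecidable ν V V' := by
    refine hG.comp (f := fun t : ℕ × ℕ => ((t.1 + 1, t.2), t.1 + t.2 + 2)) (Primrec.to_comp ?_)
    exact ((Primrec.succ.comp .fst).pair .snd).pair
      (Primrec.succ.comp (Primrec.succ.comp (Primrec.nat_add.comp .fst .snd)))
  -- Finite unions of the `C` are not assumed to have computable measure; at stage `M` these
  -- supersets, of precision `2 * M`, replace them.
  let H : (ℕ × ℕ) × ℕ → Set Y := fun t => G ((t.1.1 + 1, t.2), 2 * t.1.2)
  let H' : (ℕ × ℕ) × ℕ → Set Y := fun t => G' ((t.1.1 + 1, t.2), 2 * t.1.2)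
  have hH : AlmostDecidable ν H H' := by
    refine hG.comp (f := fun t : (ℕ × ℕ) × ℕ => ((t.1.1 + 1, t.2), 2 * t.1.2))
      (Primrec.to_comp ?_)
    exact ((Primrec.succ.comp (Primrec.fst.comp .fst)).pair .snd).pair
      (Primrec.nat_mul.comp (Primrec.const 2) (Primrec.snd.comp .fst))
  have hVC : ∀ n i, ν.real (V (n, i) \ C (n + 1) i) ≤ (1 / 2 : ℝ) ^ (n + 1 + i + 1) := by
    intro n i
    refine ((hGC (n + 1, i) (n + i + 2)).2).trans_eq ?_
    congr 1
    ring
  have hCV : ∀ n i, C (n + 1) i ⊆ V (n, i) := fun n i => (hGC (n + 1, i) (n + i + 2)).1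
  have hUopen : UniformlyCEOpen fun n => ⋃ i, V (n, i) := hV.ceOpen.iUnion
  refine ⟨fun n => ⋃ i, V (n, i), ⟨hUopen, uniformlyComputableReal_iff.2
    ⟨hν.lowerCE hUopen, ?_⟩, fun n => ?_⟩, fun n => ?_⟩
  -- Computable upper bounds for the measure of the union, converging to it as `M` grows.
  · let u : ℕ × ℕ → ℝ := fun t => ν.real (⋃ i < t.2, V (t.1, i)) +
      (ν.real (B (t.1 + 1)) - ν.real (⋃ i < t.2, H (t, i))) +
      ((1 / 2 : ℝ) ^ t.2 + (1 / 2 : ℝ) ^ t.2)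
    have hu : UniformlyComputableReal u := by
      have h1 := hV.iUnion_lt.computable_measureReal hν
      have h2 := hBm.comp (Computable.succ.comp (Computable.fst (α := ℕ) (β := ℕ)))
      have h3 := (hH.iUnion_lt.computable_measureReal hν).comp
        (Computable.id.pair (Computable.snd (α := ℕ) (β := ℕ)))
      have h4 := uniformlyComputableReal_half_pow (Computable.snd (α := ℕ) (β := ℕ))
      exact (h1.add (h2.sub h3)).add (h4.add h4)
    refine LowerCE.of_sup hu.lowerCE_neg (fun n M => neg_le_neg ?_) fun n c hc => ?_
    · have h := measureReal_iUnion_le_of_approx ν (G := fun i => V (n, i))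
        (H := fun i => H ((n, M), i)) (hCmeas (n + 1)) (hCV n)
        (fun i => (hVC n i).trans (pow_le_pow_of_le_one (by norm_num) (by norm_num) (by omega)))
        M (fun i => (hGC (n + 1, i) (2 * M)).2)
      rwa [← hBC] at h
    -- This sequence dominates `u`: it has the full union for the finite one and subtracts the
    -- smaller sets `C` instead of `H`.
    · have hlim : Tendsto (fun M => ν.real (⋃ i, V (n, i)) +
          (ν.real (B (n + 1)) - ν.real (⋃ i < M, C (n + 1) i)) +
          ((1 / 2 : ℝ) ^ M + (1 / 2 : ℝ) ^ M)) atTop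
          (𝓝 (ν.real (⋃ i, V (n, i)) + (ν.real (B (n + 1)) - ν.real (B (n + 1))) + (0 + 0))) := by
        have hp : Tendsto (fun M : ℕ => (1 / 2 : ℝ) ^ M) atTop (𝓝 0) :=
          tendsto_pow_atTop_nhds_zero_of_lt_one (by norm_num) (by norm_num)
        have hc := tendsto_measureReal_iUnion_lt ν (C (n + 1))
        rw [← hBC] at hc
        exact (tendsto_const_nhds.add (tendsto_const_nhds.sub hc)).add (hp.add hp)
      have hlt : ν.real (⋃ i, V (n, i)) + (ν.real (B (n + 1)) - ν.real (B (n + 1))) + (0 + 0) <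
          -c := by linarith
      obtain ⟨M, hM⟩ := (hlim.eventually_lt_const hlt).exists
      refine ⟨M, ?_⟩
      have h1 : ν.real (⋃ i < M, V (n, i)) ≤ ν.real (⋃ i, V (n, i)) :=
        measureReal_mono (Set.iUnion₂_subset fun i _ => Set.subset_iUnion (fun i => V (n, i)) i)
      have h2 : ν.real (⋃ i < M, C (n + 1) i) ≤ ν.real (⋃ i < M, H ((n, M), i)) :=
        measureReal_mono (Set.iUnion₂_mono fun i _ => (hGC (n + 1, i) (2 * M)).1)
          (measure_ne_top _ _)
      simp only [u]
      linarith
  · have h1 : (⋃ i, V (n, i)) ⊆ B (n + 1) ∪ ⋃ i, (V (n, i) \ C (n + 1) i) := by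
      intro x hx
      obtain ⟨i, hi⟩ := Set.mem_iUnion.1 hx
      by_cases hxC : x ∈ C (n + 1) i
      · exact Or.inl (by rw [hBC]; exact Set.mem_iUnion.2 ⟨i, hxC⟩)
      · exact Or.inr (Set.mem_iUnion.2 ⟨i, hi, hxC⟩)
    have h2 := measureReal_iUnion_le_half_pow ν (hVC n)
    calc ν.real (⋃ i, V (n, i))
        ≤ ν.real (B (n + 1)) + ν.real (⋃ i, (V (n, i) \ C (n + 1) i)) :=
          (measureReal_mono h1).trans (measureReal_union_le _ _)
      _ ≤ (1 / 2 : ℝ) ^ (n + 1) + (1 / 2 : ℝ) ^ (n + 1) := add_le_add (hle _) h2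
      _ = (1 / 2 : ℝ) ^ n := by rw [pow_succ]; ring
  · rw [hBC]
    exact Set.iUnion_mono (hCV n)

end Schnorr

theorem mainTheorem7 {Y : Type*} [MetricSpace Y] [ComputablePolishSpace Y]
    [MeasurableSpace Y] [BorelSpace Y] (ν : Measure Y) [IsProbabilityMeasure ν]
    (hν : IsComputableMeasure ν) (y : Y) :
    IsSchnorrRandom ν y ↔
      ∀ B : ℕ → Set Y, UniformlyEffectiveSigma02 ν B → (∀ n, ν.real (B n) ≤ (1 / 2 : ℝ) ^ n) →
        y ∉ ⋂ n, B n := by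
  constructor
  · intro hy B hB hle hyB
    obtain ⟨U, hU, hBU⟩ := hB.exists_schnorrTest hν hle
    exact hy U hU (Set.mem_iInter.2 fun n => hBU n (Set.mem_iInter.1 hyB (n + 1)))
  · intro h U hU
    exact h U (hU.1.uniformlyEffectiveSigma02 hν hU.2.1) hU.2.2
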